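/- For $n\in\mathbb N$ and a permutation $\sigma$ of $[n]=\{1,\dots,n\}$ let $P_\sigma$ be the $n\times n$ permutation matrix with $P_\sigma(i,j)=1$ if $\sigma(i)=j$ and $0$ otherwise, and let $P^{[2]}_\sigma=yy^{T}\in\mathbb R^{n^2\times n^2}$ with $y=\mathrm{vec}(P_\sigma)$, i.e. $P^{[2]}_\sigma(ij,kl)=P_\sigma(i,j)P_\sigma(k,l)$. The QAP-polytope is $\mathrm{QAP}_n=\mathrm{conv}\{P^{[2]}_\sigma:\sigma\in S_n\}$. A bounded relaxation of $\mathrm{QAP}_n$ is a polytope (a bounded solution set of finitely many linear inequalities) $R\subset\mathbb R^{n^2\times n^2}$ with $\mathrm{QAP}_n\subseteq R$. An extended formulation of a polytope $P\subset\mathbb R^d$ is a polytope $Q\subset\mathbb R^{d+r}$, for some $r\ge 0$, with $P=\{x\in\mathbb R^d:\exists y\in\mathbb R^r,\ (x,y)\in Q\}$. The extension complexity $\mathrm{xc}(P)$ is the minimum number of facets of an extended formulation of $P$. The QAP3 inequalities are the inequalities $$-(\beta-1)\sum_{(i,j)\in P_1\times Q}Y_{ij,ij}+\beta\sum_{(i,j)\in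 P_2\times Q}Y_{ij,ij}+\sum_{\substack{(i,j),(k,l)\in P_1\times Q\\ i<k}}Y_{ij,kl}+\sum_{\substack{(i,j),(k,l)\in P_2\times Q\\ i<k}}Y_{ij,kl}-\sum_{\substack{(i,j)\in P_1\times Q\\ (k,l)\in P_2\times Q}}Y_{ij,kl}\ \ge\ \frac{\beta-\beta^2}{2}$$ for all $\beta\in\mathbb Z$ and $P_1,P_2,Q\subseteq[n]$ with $P_1\cap P_2=\emptyset$ such that (i) $3\le|Q|\le n-3$; (ii) $|P_1|+|P_2|\le n-3$; (iii) $|P_1|\ge\min\{2,\beta+1\}$; (iv) $|P_2|\ge\min\{1,-\beta+2\}$; (v) $\bigl||P_1|-|P_2|-\beta\bigr|\le n-|Q|-4$; (vi) if $|P_2|=1$, then $|Q|\ge\min\{-\beta+5,\beta+2\}$; if $|P_2|\ge 2$, then $|Q|\ge\min\{-\beta+5,\beta+3\}$ or $|Q|\ge\min\{-\beta+4,\beta+4\}$. **Theorem.** Every bounded relaxation $R$ of $\mathrm{QAP}_n$ for which all QAP3 inequalities are valid satisfies $\mathrm{xc}(R)\ge 2^{\Omega(n)}$. That is, there are constants $c>0$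 and $N\in\mathbb N$ such that for all $n\ge N$ and every bounded relaxation $R$ of $\mathrm{QAP}_n$ for which all QAP3 inequalities are valid, $\mathrm{xc}(R)\ge 2^{cn}$. -/

import Mathlib

noncomputable section

/-- A bounded solution set of finitely many linear inequalities. -/
def IsPolytope {V : Type*} [NormedAddCommGroup V] [NormedSpace ℝ V] (S : Set V) : Prop :=
  (∃ (m : ℕ) (A : Fin m → StrongDual ℝ V) (b : Fin m → ℝ), S = {x | ∀ i, A i x ≤ b i}) ∧
    Bornology.IsBounded S

/-- `F` is a facet of `S`: a nonempty face (the set of maximizers over `S` of a linear functional)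
whose affine dimension is one less than that of `S`. -/
def IsFacet {V : Type*} [NormedAddCommGroup V] [NormedSpace ℝ V] (S F : Set V) : Prop :=
  IsExposed ℝ S F ∧ F.Nonempty ∧
    Module.finrank ℝ (vectorSpan ℝ F) + 1 = Module.finrank ℝ (vectorSpan ℝ S)

/-- The size of a polytope: its number of facets. -/
def polytopeSize {V : Type*} [NormedAddCommGroup V] [NormedSpace ℝ V] (S : Set V) : ℕ :=
  {F : Set V | IsFacet S F}.ncard

/-- `Q` is an extended formulation of `P`: a polytope, in a space with `r` further coordinates,
whose projection that forgets these coordinates is `P`. -/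
def IsExtendedFormulation {V : Type*} [NormedAddCommGroup V] [NormedSpace ℝ V] {r : ℕ}
    (Q : Set (V × (Fin r → ℝ))) (P : Set V) : Prop :=
  IsPolytope Q ∧ P = {x | ∃ y : Fin r → ℝ, (x, y) ∈ Q}

/-- The extension complexity of a polytope: the least size of an extended formulation of it. -/
def extensionComplexity {V : Type*} [NormedAddCommGroup V] [NormedSpace ℝ V] (P : Set V) : ℕ :=
  sInf {k : ℕ | ∃ (r : ℕ) (Q : Set (V × (Fin r → ℝ))),
    IsExtendedFormulation Q P ∧ polytopeSize Q = k}

/-- The space of real `n² × n²` matrices `Y`, with entries `Y (i, j) (k, l)`. -/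
abbrev QAPSpace (n : ℕ) : Type := Fin n × Fin n → Fin n × Fin n → ℝ

/-- The vertex `y yᵀ` for `y = vec (P_σ)`, where `P_σ (i, j) = 1` if `σ i = j`, and `0` otherwise. -/
def qapVertex {n : ℕ} (σ : Equiv.Perm (Fin n)) : QAPSpace n :=
  fun p q => σ.permMatrix ℝ p.1 p.2 * σ.permMatrix ℝ q.1 q.2

/-- The QAP-polytope. -/
def qapPolytope (n : ℕ) : Set (QAPSpace n) :=
  convexHull ℝ (Set.range (qapVertex (n := n)))

/-- The conditions on the parameters of the family QAP3. -/
structure IsQAP3Param (n : ℕ) (P₁ P₂ Q : Finset (Fin n)) (β : ℤ) : Prop where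
  disjoint : Disjoint P₁ P₂
  three_le_card_Q : 3 ≤ (Q.card : ℤ)
  card_Q_le : (Q.card : ℤ) ≤ (n : ℤ) - 3
  card_add_le : (P₁.card : ℤ) + P₂.card ≤ (n : ℤ) - 3
  card_P₁ : min 2 (β + 1) ≤ (P₁.card : ℤ)
  card_P₂ : min 1 (-β + 2) ≤ (P₂.card : ℤ)
  abs_le : |(P₁.card : ℤ) - P₂.card - β| ≤ (n : ℤ) - Q.card - 4
  of_card_eq_one : P₂.card = 1 → min (-β + 5) (β + 2) ≤ (Q.card : ℤ)
  of_two_le_card : 2 ≤ P₂.card →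
    min (-β + 5) (β + 3) ≤ (Q.card : ℤ) ∨ min (-β + 4) (β + 4) ≤ (Q.card : ℤ)

/-- The left-hand side of the QAP3 inequality `qap3Lhs P₁ P₂ Q β Y ≥ (β - β²) / 2`. -/
def qap3Lhs {n : ℕ} (P₁ P₂ Q : Finset (Fin n)) (β : ℤ) (Y : QAPSpace n) : ℝ :=
  -((β : ℝ) - 1) * (∑ p ∈ P₁ ×ˢ Q, Y p p)
    + (β : ℝ) * (∑ p ∈ P₂ ×ˢ Q, Y p p)
    + (∑ p ∈ P₁ ×ˢ Q, ∑ q ∈ P₁ ×ˢ Q with p.1 < q.1, Y p q)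
    + (∑ p ∈ P₂ ×ˢ Q, ∑ q ∈ P₂ ×ˢ Q with p.1 < q.1, Y p q)
    - (∑ p ∈ P₁ ×ˢ Q, ∑ q ∈ P₂ ×ˢ Q, Y p q)

/-- All inequalities of the family QAP3 are valid for the set `R`. -/
def QAP3Valid {n : ℕ} (R : Set (QAPSpace n)) : Prop :=
  ∀ (P₁ P₂ Q : Finset (Fin n)) (β : ℤ), IsQAP3Param n P₁ P₂ Q β →
    ∀ Y ∈ R, ((β : ℝ) - (β : ℝ) ^ 2) / 2 ≤ qap3Lhs P₁ P₂ Q β Y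

/-- `R` is a bounded relaxation of the QAP-polytope: a polytope that contains it. -/
def IsBoundedQAPRelaxation {n : ℕ} (R : Set (QAPSpace n)) : Prop :=
  IsPolytope R ∧ qapPolytope n ⊆ R

end

/-!
At the vertex of a permutation `σ`, the QAP3 inequality with parameters `P₁, P₂, Q, β` has slack
`(d - β) (d - β + 1) / 2`, where `d` is the number of rows of `P₁` minus the number of rows of `P₂`
that `σ` maps into `Q`. For `β = 2` and `P₂ = ∅` this is `(d - 1) (d - 2) / 2`, positive for `d = 0`
and zero for `d = 1`. With `m` about `n / 2`, suitable `P₁ = P A` and `σ = σ B`, indexed by the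
subsets `A` and `B` of an `m`-element set, have `d = |A ∩ B|`, so the support of the slack matrix
contains all disjoint pairs and no pair meeting in exactly one element.

If an inequality valid for a polytope is tight somewhere on it, then its slack at a point is
positive exactly when some facet contains all its tight points but misses the given point. Applied
to an extended formulation with `xc(R)` facets, this covers the support of the slack matrix by
`xc(R) + 1` rectangles, one of them for the inequalities that are nowhere tight. There are `3 ^ m`
disjoint pairs, and a rectangle without pairs that meet in one element contains at most `2 ^ m` of
them (Kaibel and Weltge), by induction on the ground set. Hence `xc(R) + 1 ≥ (3 / 2) ^ m`.
-/

/-- `S` is a union of `k` combinatorial rectangles; the least such `k` is the rectangle covering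
number of `S`. -/
def IsUnionOfRectangles {α β : Type*} (S : Set (α × β)) (k : ℕ) : Prop :=
  ∃ (𝒜 : Fin k → Set α) (ℬ : Fin k → Set β), S = ⋃ i, 𝒜 i ×ˢ ℬ i

theorem isUnionOfRectangles_iUnion {α β ι : Type*} [Finite ι] (𝒜 : ι → Set α) (ℬ : ι → Set β) :
    IsUnionOfRectangles (⋃ i, 𝒜 i ×ˢ ℬ i) (Nat.card ι) :=
  let e := (Finite.equivFin ι).symm
  ⟨𝒜 ∘ e, ℬ ∘ e, (e.surjective.iUnion_comp fun i => 𝒜 i ×ˢ ℬ i).symm⟩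

section UniqueDisjointness

open Finset

variable {α : Type*} [DecidableEq α] {𝒜 ℬ : Finset (Finset α)}

/-- The disjoint pairs of sets in the rectangle `𝒜 ×ˢ ℬ`. -/
def disjointPairs (𝒜 ℬ : Finset (Finset α)) : Finset (Finset α × Finset α) :=
  {p ∈ 𝒜 ×ˢ ℬ | Disjoint p.1 p.2}

theorem mem_disjointPairs {p : Finset α × Finset α} :
    p ∈ disjointPairs 𝒜 ℬ ↔ (p.1 ∈ 𝒜 ∧ p.2 ∈ ℬ) ∧ Disjoint p.1 p.2 := by
  rw [disjointPairs, mem_filter, mem_product]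

theorem card_disjointPairs_eq_add_add (e : α) (𝒜 ℬ : Finset (Finset α)) :
    #(disjointPairs 𝒜 ℬ) =
      #(disjointPairs (𝒜.nonMemberSubfamily e) (ℬ.nonMemberSubfamily e)) +
      #(disjointPairs (𝒜.nonMemberSubfamily e) (ℬ.memberSubfamily e)) +
      #(disjointPairs (𝒜.memberSubfamily e) (ℬ.nonMemberSubfamily e)) := by
  have hleft : #{p ∈ disjointPairs 𝒜 ℬ | e ∈ p.1} =
      #(disjointPairs (𝒜.memberSubfamily e) (ℬ.nonMemberSubfamily e)) := by
    refine card_nbij' (fun p => (p.1.erase e, p.2)) (fun p => (insert e p.1, p.2)) ?_ ?_ ?_ ?_ <;>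
      intro p hp <;>
      simp only [coe_filter, Set.mem_ofPred_eq, mem_coe, mem_disjointPairs,
        mem_nonMemberSubfamily, mem_memberSubfamily] at hp ⊢ <;>
      grind [insert_erase, erase_insert, disjoint_left]
  have hright : #{p ∈ {p ∈ disjointPairs 𝒜 ℬ | e ∉ p.1} | e ∈ p.2} =
      #(disjointPairs (𝒜.nonMemberSubfamily e) (ℬ.memberSubfamily e)) := by
    refine card_nbij' (fun p => (p.1, p.2.erase e)) (fun p => (p.1, insert e p.2)) ?_ ?_ ?_ ?_ <;>
      intro p hp <;>
      simp only [coe_filter, Set.mem_ofPred_eq, mem_coe, mem_filter, mem_disjointPairs,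
        mem_nonMemberSubfamily, mem_memberSubfamily] at hp ⊢ <;>
      grind [insert_erase, erase_insert, disjoint_left]
  have hnone : {p ∈ {p ∈ disjointPairs 𝒜 ℬ | e ∉ p.1} | e ∉ p.2} =
      disjointPairs (𝒜.nonMemberSubfamily e) (ℬ.nonMemberSubfamily e) := by
    ext p
    simp only [mem_filter, mem_disjointPairs, mem_nonMemberSubfamily]
    tauto
  rw [← card_filter_add_card_filter_not (fun p => e ∈ p.1),
    ← card_filter_add_card_filter_not (s := {p ∈ disjointPairs 𝒜 ℬ | e ∉ p.1}) (fun p => e ∈ p.2),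
    hleft, hright, hnone]
  ring

theorem nonMemberSubfamily_powerset_insert {e : α} {U : Finset α} (he : e ∉ U) :
    (insert e U).powerset.nonMemberSubfamily e = U.powerset := by
  ext A
  rw [mem_nonMemberSubfamily, mem_powerset, mem_powerset]
  exact ⟨fun h => (subset_insert_iff_of_notMem h.2).1 h.1,
    fun h => ⟨h.trans (subset_insert e U), fun heA => he (h heA)⟩⟩

theorem memberSubfamily_powerset_insert {e : α} {U : Finset α} (he : e ∉ U) :
    (insert e U).powerset.memberSubfamily e = U.powerset := by
  ext A
  rw [mem_memberSubfamily, mem_powerset, mem_powerset]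
  exact ⟨fun h => (insert_subset_insert_iff h.2).1 h.1,
    fun h => ⟨insert_subset_insert e h, fun heA => he (h heA)⟩⟩

theorem card_disjointPairs_powerset (U : Finset α) :
    #(disjointPairs U.powerset U.powerset) = 3 ^ #U := by
  induction U using Finset.induction_on with
  | empty => rfl
  | insert e U he ih =>
    rw [card_disjointPairs_eq_add_add e, nonMemberSubfamily_powerset_insert he,
      memberSubfamily_powerset_insert he, ih, card_insert_of_notMem he]
    ring

theorem card_disjointPairs_le_add {e : α} (h : ∀ A ∈ 𝒜, ∀ B ∈ ℬ, #(A ∩ B) ≠ 1) :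
    #(disjointPairs 𝒜 ℬ) ≤
      #(disjointPairs (𝒜.nonMemberSubfamily e ∪ 𝒜.memberSubfamily e) (ℬ.nonMemberSubfamily e)) +
      #(disjointPairs (𝒜.nonMemberSubfamily e)
        (ℬ.nonMemberSubfamily e ∪ ℬ.memberSubfamily e)) := by
  have hsplit := card_disjointPairs_eq_add_add e 𝒜 ℬ
  set 𝒜₀ := 𝒜.nonMemberSubfamily e
  set 𝒜₁ := 𝒜.memberSubfamily e with h𝒜₁
  set ℬ₀ := ℬ.nonMemberSubfamily e
  set ℬ₁ := ℬ.memberSubfamily e with hℬ₁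
  -- `A ∪ {e}` and `B ∪ {e}` cannot both lie in the rectangle: they would meet exactly in `e`.
  have hexcl : ∀ A ∈ 𝒜₁, ∀ B ∈ ℬ₁, ¬ Disjoint A B := by
    intro A hA B hB hAB
    rw [h𝒜₁, mem_memberSubfamily] at hA
    rw [hℬ₁, mem_memberSubfamily] at hB
    apply h _ hA.1 _ hB.1
    rw [← insert_inter_distrib, disjoint_iff_inter_eq_empty.1 hAB, card_insert_of_notMem (by simp),
      card_empty]
  have hunion : disjointPairs (𝒜₀ ∪ 𝒜₁) ℬ₀ = disjointPairs 𝒜₀ ℬ₀ ∪ disjointPairs 𝒜₁ ℬ₀ := by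
    simp only [disjointPairs, union_product, filter_union]
  have hinter : #(disjointPairs 𝒜₀ ℬ₀ ∩ disjointPairs 𝒜₁ ℬ₀) + #(disjointPairs 𝒜₀ ℬ₁) ≤
      #(disjointPairs 𝒜₀ (ℬ₀ ∪ ℬ₁)) := by
    rw [← card_union_of_disjoint]
    · apply card_le_card
      intro p
      simp only [mem_union, mem_inter, mem_disjointPairs]
      tauto
    · rw [disjoint_left]
      simp only [mem_inter, mem_disjointPairs]
      rintro p ⟨-, ⟨hA, -⟩, hp⟩ ⟨⟨-, hB⟩, -⟩
      exact hexcl _ hA _ hB hp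
  have hinclExcl := card_union_add_card_inter (disjointPairs 𝒜₀ ℬ₀) (disjointPairs 𝒜₁ ℬ₀)
  rw [hunion]
  omega

theorem card_disjointPairs_le_two_pow (U : Finset α)
    (h𝒜 : 𝒜 ⊆ U.powerset) (hℬ : ℬ ⊆ U.powerset) (h : ∀ A ∈ 𝒜, ∀ B ∈ ℬ, #(A ∩ B) ≠ 1) :
    #(disjointPairs 𝒜 ℬ) ≤ 2 ^ #U := by
  induction U using Finset.induction_on generalizing 𝒜 ℬ with
  | empty => exact card_le_card (filter_subset_filter _ (product_subset_product h𝒜 hℬ))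
  | insert e U he ih =>
    have hnonMember : ∀ {𝒞 : Finset (Finset α)}, 𝒞 ⊆ (insert e U).powerset →
        𝒞.nonMemberSubfamily e ⊆ U.powerset := fun h𝒞 => by
      rw [← nonMemberSubfamily_powerset_insert he]
      exact filter_subset_filter _ h𝒞
    have hmember : ∀ {𝒞 : Finset (Finset α)}, 𝒞 ⊆ (insert e U).powerset →
        𝒞.memberSubfamily e ⊆ U.powerset := fun h𝒞 => by
      rw [← memberSubfamily_powerset_insert he]
      exact image_subset_image (filter_subset_filter _ h𝒞)
    rw [card_insert_of_notMem he, pow_succ, mul_two]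
    refine (card_disjointPairs_le_add (e := e) h).trans (add_le_add (ih ?_ ?_ ?_) (ih ?_ ?_ ?_))
    · exact union_subset (hnonMember h𝒜) (hmember h𝒜)
    · exact hnonMember hℬ
    · intro A hA B hB
      simp only [mem_union, mem_nonMemberSubfamily, mem_memberSubfamily] at hA hB
      rcases hA with hA | hA
      · exact h A hA.1 B hB.1
      · simpa only [insert_inter_of_notMem hB.2] using h _ hA.1 B hB.1
    · exact hnonMember h𝒜
    · exact union_subset (hnonMember hℬ) (hmember hℬ)
    · intro A hA B hB
      simp only [mem_union, mem_nonMemberSubfamily, mem_memberSubfamily] at hA hB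
      rcases hB with hB | hB
      · exact h A hA.1 B hB.1
      · simpa only [inter_insert_of_notMem hA.2] using h A hA.1 _ hB.1

theorem IsUnionOfRectangles.three_pow_le_mul_two_pow [Fintype α]
    {S : Set (Finset α × Finset α)} {k : ℕ} (hS : IsUnionOfRectangles S k)
    (hdisj : ∀ A B : Finset α, Disjoint A B → (A, B) ∈ S)
    (hone : ∀ A B : Finset α, #(A ∩ B) = 1 → (A, B) ∉ S) :
    3 ^ Fintype.card α ≤ k * 2 ^ Fintype.card α := by
  classical
  obtain ⟨𝒜, ℬ, rfl⟩ := hS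
  have hcover : disjointPairs univ univ ⊆
      univ.biUnion fun i => disjointPairs {A | A ∈ 𝒜 i} {B | B ∈ ℬ i} := by
    intro p hp
    obtain ⟨i, hi⟩ := Set.mem_iUnion.1 (hdisj p.1 p.2 (mem_disjointPairs.1 hp).2)
    rw [mem_biUnion]
    exact ⟨i, mem_univ i, by simpa [mem_disjointPairs] using ⟨hi, (mem_disjointPairs.1 hp).2⟩⟩
  calc 3 ^ Fintype.card α = #(disjointPairs (univ : Finset (Finset α)) univ) := by
        rw [← powerset_univ, card_disjointPairs_powerset, card_univ]
    _ ≤ k * 2 ^ Fintype.card α := by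
        refine (card_le_card hcover).trans ((card_biUnion_le_card_mul _ _ _ fun i _ => ?_).trans_eq
          (by rw [card_univ, Fintype.card_fin]))
        refine card_disjointPairs_le_two_pow univ (by simp) (by simp) fun A hA B hB hAB => ?_
        exact hone A B hAB (Set.mem_iUnion.2 ⟨i, (mem_filter.1 hA).2, (mem_filter.1 hB).2⟩)

end UniqueDisjointness

section Polyhedron

open Filter Topology

variable {E : Type*} [NormedAddCommGroup E] [NormedSpace ℝ E] {ι : Type*}
  {A : ι → StrongDual ℝ E} {b : ι → ℝ}

/-- The polyhedron `{x | A x ≤ b}`. Irredundancy and active sets depend on the system `(A, b)`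
and not only on the set, so the system is kept as a parameter. -/
def polyhedron (A : ι → StrongDual ℝ E) (b : ι → ℝ) : Set E :=
  {x | ∀ i, A i x ≤ b i}

/-- The active set at `x` of the system `A x ≤ b`: the constraints that are tight at `x`. -/
def activeSet (A : ι → StrongDual ℝ E) (b : ι → ℝ) (x : E) : Set ι :=
  {i | A i x = b i}

theorem convex_polyhedron (A : ι → StrongDual ℝ E) (b : ι → ℝ) : Convex ℝ (polyhedron A b) := by
  rw [polyhedron, Set.ofPred_forall]
  exact convex_iInter fun i => convex_halfSpace_le (A i).isLinear (b i)

theorem exists_activeSet_minimal [Finite ι] {C : Set E} (hC : Convex ℝ C) (hne : C.Nonempty)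
    (hle : C ⊆ polyhedron A b) : ∃ x₀ ∈ C, ∀ x ∈ C, activeSet A b x₀ ⊆ activeSet A b x := by
  obtain ⟨x₀, hx₀, hmin⟩ := exists_minimalFor_of_wellFoundedLT (· ∈ C) (activeSet A b) hne
  refine ⟨x₀, hx₀, fun x hx i hi => ?_⟩
  have hmid : midpoint ℝ x₀ x ∈ C := hC.midpoint_mem hx₀ hx
  have heval : ∀ j, A j (midpoint ℝ x₀ x) = (A j x₀ + A j x) / 2 := fun j => by
    simp [midpoint_eq_smul_add, inv_mul_eq_div, add_div]
  have hsub : activeSet A b (midpoint ℝ x₀ x) ⊆ activeSet A b x₀ := fun j hj => by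
    have hj : A j (midpoint ℝ x₀ x) = b j := hj
    rw [heval] at hj
    exact le_antisymm (hle hx₀ j) (by linarith [hle hx j])
  have hmid_i : A i (midpoint ℝ x₀ x) = b i := hmin hmid hsub hi
  have hi : A i x₀ = b i := hi
  rw [heval] at hmid_i
  exact show A i x = b i by linarith

theorem exists_pos_add_smul_mem_polyhedron [Finite ι] {x v : E} (hx : x ∈ polyhedron A b)
    (hv : ∀ i ∈ activeSet A b x, A i v ≤ 0) : ∃ ε > (0 : ℝ), x + ε • v ∈ polyhedron A b := by
  have hstep : ∀ᶠ ε : ℝ in 𝓝[>] 0, ∀ i, A i (x + ε • v) ≤ b i := by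
    refine eventually_all.2 fun i => ?_
    rcases (hx i).eq_or_lt with hi | hi
    · filter_upwards [self_mem_nhdsWithin] with ε hε
      rw [map_add, map_smul, hi, smul_eq_mul]
      linarith [mul_nonpos_of_nonneg_of_nonpos (le_of_lt hε) (hv i hi)]
    · have hcont : Continuous fun ε : ℝ => A i (x + ε • v) := by fun_prop
      have hlim := (hcont.tendsto 0).mono_left (nhdsWithin_le_nhds (s := Set.Ioi 0))
      exact (hlim.eventually_lt_const (by simpa using hi)).mono fun ε => le_of_lt
  obtain ⟨ε, hε, hpos⟩ := (hstep.and self_mem_nhdsWithin).exists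
  exact ⟨ε, hpos, hε⟩

theorem eq_of_activeSet_subset [Finite ι] {f : E →ₗ[ℝ] ℝ} {c : ℝ}
    (hf : ∀ x ∈ polyhedron A b, f x ≤ c) {x₀ x : E} (hx₀ : x₀ ∈ polyhedron A b) (hfx₀ : f x₀ = c)
    (hx : x ∈ polyhedron A b) (h : activeSet A b x₀ ⊆ activeSet A b x) : f x = c := by
  -- The segment from `x` to `x₀` can be prolonged beyond `x₀` inside the polyhedron.
  obtain ⟨ε, hε, hmem⟩ := exists_pos_add_smul_mem_polyhedron (v := x₀ - x) hx₀ fun i hi => by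
    have hi₀ : A i x₀ = b i := hi
    have hi₁ : A i x = b i := h hi
    rw [map_sub, hi₀, hi₁, sub_self]
  refine le_antisymm (hf x hx) ?_
  have hprolong := hf _ hmem
  rw [map_add, map_smul, map_sub, hfx₀, smul_eq_mul] at hprolong
  exact sub_nonpos.1 (nonpos_of_mul_nonpos_right (by linarith) hε)

theorem exists_eq_setOf_subset_activeSet [Finite ι] {F : Set E}
    (hF : IsExposed ℝ (polyhedron A b) F) (hne : F.Nonempty) :
    ∃ I : Set ι, F = {x ∈ polyhedron A b | I ⊆ activeSet A b x} := by
  obtain ⟨x₀, hx₀, hmin⟩ := exists_activeSet_minimal (hF.convex (convex_polyhedron A b)) hne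
    hF.subset
  obtain ⟨l, rfl⟩ := hF hne
  refine ⟨activeSet A b x₀, Set.Subset.antisymm (fun x hx => ⟨hx.1, hmin x hx⟩) fun x hx => ?_⟩
  have hlx : l x = l x₀ :=
    eq_of_activeSet_subset (f := l.toLinearMap) hx₀.2 hx₀.1 rfl hx.1 hx.2
  exact ⟨hx.1, fun y hy => hlx ▸ hx₀.2 y hy⟩

theorem IsPolytope.finite_setOf_isFacet {S : Set E} (hS : IsPolytope S) :
    {F | IsFacet S F}.Finite := by
  obtain ⟨⟨m, A, b, rfl⟩, -⟩ := hS
  refine (Set.finite_range fun I => {x ∈ polyhedron A b | I ⊆ activeSet A b x}).subset ?_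
  rintro F ⟨hexp, hne, -⟩
  obtain ⟨I, rfl⟩ := exists_eq_setOf_subset_activeSet hexp hne
  exact ⟨I, rfl⟩

/-- No constraint of the system `A x ≤ b` is implied by the others. -/
def IsIrredundant (A : ι → StrongDual ℝ E) (b : ι → ℝ) : Prop :=
  ∀ j, ∃ x, (∀ i, i ≠ j → A i x ≤ b i) ∧ b j < A j x

theorem IsPolytope.exists_isIrredundant {S : Set E} (hS : IsPolytope S) :
    ∃ (m : ℕ) (A : Fin m → StrongDual ℝ E) (b : Fin m → ℝ),
      IsIrredundant A b ∧ S = polyhedron A b := by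
  classical
  have hex : ∃ (m : ℕ) (A : Fin m → StrongDual ℝ E) (b : Fin m → ℝ), S = polyhedron A b := hS.1
  obtain ⟨A, b, hSA⟩ := Nat.find_spec hex
  refine ⟨_, A, b, fun j => ?_, hSA⟩
  by_contra! hredundant
  obtain ⟨k, hk⟩ : ∃ k, Nat.find hex = k + 1 := Nat.exists_eq_add_one.2 j.pos
  refine Nat.find_min hex (m := k) (by omega) ?_
  generalize Nat.find hex = m at *
  subst hk
  refine ⟨A ∘ j.succAbove, b ∘ j.succAbove, hSA.trans (Set.ext fun x => ?_)⟩
  refine ⟨fun hx i => hx _, fun hx => (Fin.forall_iff_succAbove j).2 ⟨hredundant x ?_, hx⟩⟩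
  intro i hij
  obtain ⟨i, rfl⟩ := Fin.exists_succAbove_eq hij
  exact hx i

theorem IsIrredundant.exists_activeSet_subset_insert [Finite ι] (hirr : IsIrredundant A b)
    {j : ι} {z : E} (hz : z ∈ polyhedron A b) (hzj : j ∉ activeSet A b z) :
    ∃ d ∈ polyhedron A b, A j d = b j ∧
      ∀ x ∈ polyhedron A b, activeSet A b d ⊆ insert j (activeSet A b x) := by
  obtain ⟨d₀, hd₀, hmin⟩ := exists_activeSet_minimal (convex_polyhedron A b) ⟨z, hz⟩ subset_rfl
  obtain ⟨d₁, hd₁, hj₁⟩ := hirr j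
  have hj₀ : A j d₀ < b j := (hd₀ j).lt_of_ne fun h => hzj (hmin z hz h)
  -- Constraint `j` is tight at the point with parameter `t` on the segment from `d₀` to `d₁`.
  have hlt : 0 < A j d₁ - A j d₀ := by linarith
  set t := (b j - A j d₀) / (A j d₁ - A j d₀)
  have ht0 : 0 < t := div_pos (by linarith) hlt
  have ht1 : t < 1 := (div_lt_one hlt).2 (by linarith)
  have heval : ∀ i, A i (AffineMap.lineMap d₀ d₁ t) = (1 - t) * A i d₀ + t * A i d₁ := fun i => by
    simp [AffineMap.lineMap_apply_module]
  have hdj : A j (AffineMap.lineMap d₀ d₁ t) = b j := by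
    have := div_mul_cancel₀ (b j - A j d₀) hlt.ne'
    rw [heval]
    linarith
  refine ⟨AffineMap.lineMap d₀ d₁ t, fun i => ?_, hdj, fun x hx i hi => ?_⟩
  · by_cases hij : i = j
    · rw [hij, hdj]
    · rw [heval]
      nlinarith [hd₀ i, hd₁ i hij]
  · refine or_iff_not_imp_left.2 fun hij => hmin x hx ?_
    have hi : A i (AffineMap.lineMap d₀ d₁ t) = b i := hi
    rw [heval] at hi
    exact (hd₀ i).antisymm (by nlinarith [hd₁ i hij])

theorem map_eq_zero_of_mem_vectorSpan {K V W : Type*} [Ring K] [AddCommGroup V] [Module K V]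
    [AddCommGroup W] [Module K W] {S : Set V} {φ : V →ₗ[K] W} {c : W} (h : ∀ x ∈ S, φ x = c)
    {v : V} (hv : v ∈ vectorSpan K S) : φ v = 0 := by
  have hle : vectorSpan K S ≤ LinearMap.ker φ := by
    rw [vectorSpan_def, Submodule.span_le]
    rintro _ ⟨x, hx, y, hy, rfl⟩
    simp [h x hx, h y hy]
  exact hle hv

theorem vectorSpan_polyhedron_inter_hyperplane [Finite ι] {j : ι} {d : E}
    (hd : d ∈ polyhedron A b) (hdj : A j d = b j)
    (hactive : ∀ x ∈ polyhedron A b, activeSet A b d ⊆ insert j (activeSet A b x)) :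
    vectorSpan ℝ {x ∈ polyhedron A b | A j x = b j} =
      vectorSpan ℝ (polyhedron A b) ⊓ LinearMap.ker (A j).toLinearMap := by
  refine le_antisymm (fun v hv => ⟨vectorSpan_mono ℝ (fun x hx => hx.1) hv,
    map_eq_zero_of_mem_vectorSpan (fun x hx => hx.2) hv⟩) ?_
  rintro v ⟨hv, hvj⟩
  have hvj : A j v = 0 := hvj
  have hzero : ∀ i ∈ activeSet A b d, A i v = 0 := by
    intro i hi
    by_cases hij : i = j
    · rw [hij, hvj]
    · exact map_eq_zero_of_mem_vectorSpan (φ := (A i).toLinearMap)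
        (fun x hx => (hactive x hx hi).resolve_left hij) hv
  obtain ⟨ε, hε, hmem⟩ := exists_pos_add_smul_mem_polyhedron hd fun i hi => (hzero i hi).le
  have hface : d + ε • v ∈ {x ∈ polyhedron A b | A j x = b j} := ⟨hmem, by simp [hdj, hvj]⟩
  have hεv := vsub_mem_vectorSpan ℝ hface (show d ∈ _ from ⟨hd, hdj⟩)
  rw [vsub_eq_sub, add_sub_cancel_left] at hεv
  exact (Submodule.smul_mem_iff _ hε.ne').1 hεv

theorem finrank_inf_ker_add_one {K V : Type*} [Field K] [AddCommGroup V] [Module K V]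
    {W : Submodule K V} [FiniteDimensional K W] {φ : Module.Dual K V} {v : V} (hv : v ∈ W)
    (hφv : φ v ≠ 0) :
    Module.finrank K (W ⊓ LinearMap.ker φ : Submodule K V) + 1 = Module.finrank K W := by
  have hφ : φ.domRestrict W ≠ 0 := fun h => hφv (LinearMap.congr_fun h ⟨v, hv⟩)
  rw [← Module.Dual.finrank_ker_add_one_of_ne_zero hφ, LinearMap.ker_domRestrict,
    ← Submodule.map_comap_subtype, Submodule.finrank_map_subtype_eq]

theorem IsIrredundant.isFacet [Finite ι] [FiniteDimensional ℝ E] (hirr : IsIrredundant A b)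
    {j : ι} {z : E} (hz : z ∈ polyhedron A b) (hzj : j ∉ activeSet A b z) :
    IsFacet (polyhedron A b) {x ∈ polyhedron A b | A j x = b j} := by
  obtain ⟨d, hd, hdj, hactive⟩ := hirr.exists_activeSet_subset_insert hz hzj
  have hexposed : {x ∈ polyhedron A b | A j x = b j} = (A j).toExposed (polyhedron A b) :=
    Set.ext fun x => and_congr_right fun hx =>
      ⟨fun hxj y hy => hxj ▸ hy j, fun hmax => (hx j).antisymm (hdj ▸ hmax d hd)⟩
  refine ⟨hexposed ▸ ContinuousLinearMap.toExposed.isExposed, ⟨d, hd, hdj⟩, ?_⟩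
  rw [vectorSpan_polyhedron_inter_hyperplane hd hdj hactive]
  refine finrank_inf_ker_add_one (vsub_mem_vectorSpan ℝ hd hz) fun h => hzj ?_
  have h : A j (d - z) = 0 := h
  rw [map_sub, hdj] at h
  exact (sub_eq_zero.1 h).symm

theorem IsPolytope.exists_isFacet_of_lt [FiniteDimensional ℝ E] {S : Set E} (hS : IsPolytope S)
    {f : E →ₗ[ℝ] ℝ} {c : ℝ} (hf : ∀ x ∈ S, f x ≤ c) (hne : ∃ x ∈ S, f x = c) {z : E}
    (hz : z ∈ S) (hfz : f z < c) :
    ∃ F, IsFacet S F ∧ z ∉ F ∧ ∀ x ∈ S, f x = c → x ∈ F := by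
  obtain ⟨m, A, b, hirr, rfl⟩ := hS.exists_isIrredundant
  obtain ⟨x₀, ⟨hx₀, hfx₀⟩, hmin⟩ := exists_activeSet_minimal (A := A) (b := b)
    (C := {x ∈ polyhedron A b | f x = c})
    ((convex_polyhedron A b).inter (convex_hyperplane f.isLinear c)) hne fun x hx => hx.1
  obtain ⟨j, hj, hjz⟩ : ∃ j ∈ activeSet A b x₀, j ∉ activeSet A b z :=
    Set.not_subset.1 fun h => hfz.ne (eq_of_activeSet_subset hf hx₀ hfx₀ hz h)
  exact ⟨_, hirr.isFacet hz hjz, fun h => hjz h.2, fun x hx hfx => ⟨hx, hmin x ⟨hx, hfx⟩ hj⟩⟩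

theorem IsPolytope.isUnionOfRectangles_slack_polytopeSize [FiniteDimensional ℝ E] {S : Set E}
    (hS : IsPolytope S) {I J : Type*} {f : I → E →ₗ[ℝ] ℝ} {c : I → ℝ}
    (hf : ∀ i, ∀ x ∈ S, f i x ≤ c i) {v : J → E} (hv : ∀ j, v j ∈ S) :
    IsUnionOfRectangles {p : I × J | f p.1 (v p.2) < c p.1} (polytopeSize S + 1) := by
  have : Finite {F | IsFacet S F} := hS.finite_setOf_isFacet
  -- One rectangle for each facet, and one for the inequalities that are nowhere tight on `S`.
  let 𝒜 : Option {F | IsFacet S F} → Set I := fun k =>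
    k.elim {i | ∀ x ∈ S, f i x ≠ c i} fun F => {i | ∀ x ∈ S, f i x = c i → x ∈ F.1}
  let ℬ : Option {F | IsFacet S F} → Set J := fun k => k.elim Set.univ fun F => {j | v j ∉ F.1}
  have hcard : Nat.card (Option {F | IsFacet S F}) = polytopeSize S + 1 := Finite.card_option
  suffices hcover : {p : I × J | f p.1 (v p.2) < c p.1} = ⋃ k, 𝒜 k ×ˢ ℬ k by
    rw [hcover, ← hcard]
    exact isUnionOfRectangles_iUnion 𝒜 ℬ
  ext ⟨i, j⟩
  rw [Set.mem_iUnion]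
  constructor
  · intro hlt
    by_cases hne : ∃ x ∈ S, f i x = c i
    · obtain ⟨F, hF, hjF, hiF⟩ := hS.exists_isFacet_of_lt (hf i) hne (hv j) hlt
      exact ⟨some ⟨F, hF⟩, hiF, hjF⟩
    · exact ⟨none, fun x hx h => hne ⟨x, hx, h⟩, trivial⟩
  · rintro ⟨_ | F, hi, hj⟩
    · exact (hf i _ (hv j)).lt_of_ne (hi _ (hv j))
    · exact (hf i _ (hv j)).lt_of_ne fun h => hj (hi _ (hv j) h)

theorem IsPolytope.exists_isExtendedFormulation {P : Set E} (hP : IsPolytope P) :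
    ∃ (r : ℕ) (Q : Set (E × (Fin r → ℝ))),
      IsExtendedFormulation Q P ∧ polytopeSize Q = extensionComplexity P := by
  refine Nat.sInf_mem (s := {k | ∃ (r : ℕ) (Q : Set (E × (Fin r → ℝ))),
    IsExtendedFormulation Q P ∧ polytopeSize Q = k}) ⟨_, 0, P ×ˢ Set.univ, ⟨⟨?_, ?_⟩, ?_⟩, rfl⟩
  · obtain ⟨⟨m, A, b, rfl⟩, -⟩ := hP
    exact ⟨m, fun i => (A i).comp (.fst ℝ E (Fin 0 → ℝ)), b, by ext; simp⟩
  · exact hP.2.prod Set.finite_univ.isBounded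
  · simp

theorem IsPolytope.isUnionOfRectangles_slack_extensionComplexity [FiniteDimensional ℝ E]
    {P : Set E} (hP : IsPolytope P) {I J : Type*} {f : I → E →ₗ[ℝ] ℝ} {c : I → ℝ}
    (hf : ∀ i, ∀ x ∈ P, f i x ≤ c i) {v : J → E} (hv : ∀ j, v j ∈ P) :
    IsUnionOfRectangles {p : I × J | f p.1 (v p.2) < c p.1} (extensionComplexity P + 1) := by
  obtain ⟨r, Q, ⟨hQ, hproj⟩, hsize⟩ := hP.exists_isExtendedFormulation
  have hlift : ∀ j, ∃ y, (v j, y) ∈ Q := fun j => by simpa [hproj] using hv j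
  choose y hy using hlift
  rw [← hsize]
  exact hQ.isUnionOfRectangles_slack_polytopeSize (f := fun i => f i ∘ₗ LinearMap.fst ℝ E _)
    (fun i x hx => hf i x.1 (hproj ▸ ⟨x.2, hx⟩)) hy

end Polyhedron

section QAP

open Finset

theorem sum_card_filter_lt_eq_choose_two {α : Type*} [LinearOrder α] (s : Finset α) :
    ∑ i ∈ s, #{k ∈ s | i < k} = (#s).choose 2 := by
  induction s using Finset.induction_on_max with
  | empty => rfl
  | insert a s ha ih =>
    have haa : a ∉ s := fun h => (ha a h).false
    have htop : {k ∈ insert a s | a < k} = ∅ := by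
      rw [filter_eq_empty_iff, forall_mem_insert]
      exact ⟨lt_irrefl a, fun k hk => (ha k hk).not_gt⟩
    have hbelow : ∀ i ∈ s, #{k ∈ insert a s | i < k} = #{k ∈ s | i < k} + 1 := fun i hi => by
      rw [filter_insert, if_pos (ha i hi), card_insert_of_notMem (by simp [haa])]
    rw [sum_insert haa, htop, card_empty, zero_add, sum_congr rfl hbelow, sum_add_distrib, ih,
      sum_const, smul_eq_mul, mul_one, card_insert_of_notMem haa, Nat.choose_succ_succ',
      Nat.choose_one_right, add_comm]

theorem exists_perm_forall_mem_iff {α : Type*} [Fintype α] [DecidableEq α] {B V Q : Finset α}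
    (hBQ : #B ≤ #Q) (hQ : #Q ≤ #(B ∪ Vᶜ)) :
    ∃ σ : Equiv.Perm α, ∀ i ∈ V, σ i ∈ Q ↔ i ∈ B := by
  obtain ⟨C, hBC, hCV, hC⟩ := exists_subsuperset_card_eq subset_union_left hBQ hQ
  obtain ⟨σ, rfl⟩ := Equiv.Perm.exists_map_finset_eq C Q hC
  refine ⟨σ, fun i hi => ?_⟩
  rw [mem_map_equiv, Equiv.symm_apply_apply]
  refine ⟨fun hiC => (mem_union.1 (hCV hiC)).resolve_right ?_, fun hiB => hBC hiB⟩
  exact fun h => mem_compl.1 h hi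

variable {n : ℕ}

/-- The left-hand side of a QAP3 inequality as a linear form on matrices. -/
def qap3LhsLinear (P₁ P₂ Q : Finset (Fin n)) (β : ℤ) : QAPSpace n →ₗ[ℝ] ℝ where
  toFun := qap3Lhs P₁ P₂ Q β
  map_add' Y Z := by
    simp only [qap3Lhs, Pi.add_apply, sum_add_distrib]
    ring
  map_smul' a Y := by
    simp only [qap3Lhs, Pi.smul_apply, smul_eq_mul, ← mul_sum, RingHom.id_apply]
    ring

theorem sum_permMatrix_mul {α R : Type*} [DecidableEq α] [NonAssocSemiring R] (σ : Equiv.Perm α)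
    (P Q : Finset α) (g : α → R) :
    ∑ p ∈ P ×ˢ Q, σ.permMatrix R p.1 p.2 * g p.1 = ∑ i ∈ P with σ i ∈ Q, g i := by
  simp [sum_product, sum_filter, Equiv.Perm.permMatrix, PEquiv.toMatrix_apply]

theorem sum_sum_qapVertex (P P' Q : Finset (Fin n)) (σ : Equiv.Perm (Fin n))
    (r : Fin n → Fin n → Prop) [DecidableRel r] :
    ∑ p ∈ P ×ˢ Q, ∑ q ∈ P' ×ˢ Q with r p.1 q.1, qapVertex σ p q =
      ((∑ i ∈ P with σ i ∈ Q, #{k ∈ {k ∈ P' | σ k ∈ Q} | r i k} : ℕ) : ℝ) := by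
  have hinner : ∀ i, ∑ q ∈ P' ×ˢ Q with r i q.1, σ.permMatrix ℝ q.1 q.2 =
      #{k ∈ {k ∈ P' | σ k ∈ Q} | r i k} := fun i => by
    simpa only [sum_filter (fun q : Fin n × Fin n => r i q.1), mul_ite, mul_one, mul_zero,
      sum_boole] using sum_permMatrix_mul σ P' Q fun k => if r i k then (1 : ℝ) else 0
  simp only [qapVertex, ← mul_sum, hinner]
  rw [sum_permMatrix_mul σ P Q fun i => (#{k ∈ {k ∈ P' | σ k ∈ Q} | r i k} : ℝ), Nat.cast_sum]

theorem qap3Lhs_qapVertex (P₁ P₂ Q : Finset (Fin n)) (β : ℤ) (σ : Equiv.Perm (Fin n)) {d : ℝ}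
    (hd : d = #{i ∈ P₁ | σ i ∈ Q} - #{i ∈ P₂ | σ i ∈ Q}) :
    qap3Lhs P₁ P₂ Q β (qapVertex σ) = (β - β ^ 2) / 2 + (d - β) * (d - β + 1) / 2 := by
  have hdiag : ∀ P : Finset (Fin n),
      ∑ p ∈ P ×ˢ Q, qapVertex σ p p = #{i ∈ P | σ i ∈ Q} := fun P => by
    simp [sum_product, qapVertex, Equiv.Perm.permMatrix, PEquiv.toMatrix_apply]
  have hlt : ∀ P : Finset (Fin n), ∑ p ∈ P ×ˢ Q, ∑ q ∈ P ×ˢ Q with p.1 < q.1, qapVertex σ p q =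
      (#{i ∈ P | σ i ∈ Q} : ℝ) * (#{i ∈ P | σ i ∈ Q} - 1) / 2 := fun P => by
    rw [sum_sum_qapVertex P P Q σ (· < ·), sum_card_filter_lt_eq_choose_two, Nat.cast_choose_two]
  have hcross : ∑ p ∈ P₁ ×ˢ Q, ∑ q ∈ P₂ ×ˢ Q, qapVertex σ p q =
      (#{i ∈ P₁ | σ i ∈ Q} : ℝ) * #{i ∈ P₂ | σ i ∈ Q} := by
    simpa using sum_sum_qapVertex P₁ P₂ Q σ fun _ _ => True
  simp only [qap3Lhs, hdiag, hlt, hcross, hd]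
  ring

theorem isQAP3Param_empty_two_iff {P Q : Finset (Fin n)} :
    IsQAP3Param n P ∅ Q 2 ↔ 2 ≤ #P ∧ 3 ≤ #Q ∧ #P + #Q + 2 ≤ n := by
  have hempty : #(∅ : Finset (Fin n)) = 0 := card_empty
  constructor
  · intro h
    have hP := h.card_P₁
    have hQ := h.three_le_card_Q
    have hPQ := (abs_le.1 h.abs_le).2
    omega
  · rintro ⟨hP, hQ, hPQ⟩
    have hPabs : |(#P : ℤ) - #(∅ : Finset (Fin n)) - 2| ≤ n - #Q - 4 := by
      rw [abs_le]
      omega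
    refine ⟨disjoint_empty_right P, ?_, ?_, ?_, ?_, ?_, hPabs, ?_, ?_⟩ <;> omega

theorem exists_isQAP3Param_card_eq_card_inter {m : ℕ} (hmn : 2 * m + 7 ≤ n) :
    ∃ (Q : Finset (Fin n)) (P : Finset (Fin m) → Finset (Fin n))
      (σ : Finset (Fin m) → Equiv.Perm (Fin n)), (∀ A, IsQAP3Param n (P A) ∅ Q 2) ∧
        ∀ A B, #{i ∈ P A | σ B i ∈ Q} = #(A ∩ B) := by
  let e : Fin m ↪ Fin n := Fin.castLEEmb (by omega)
  have hmap : ∀ A : Finset (Fin m), A.map e ⊆ univ.map e := fun A =>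
    map_subset_map.2 (subset_univ A)
  have hcompl : #(univ.map e)ᶜ = n - m := by
    rw [card_compl, card_map, card_univ, Fintype.card_fin, Fintype.card_fin]
  -- Two rows that no `σ B` maps into `Q` bring `#(P A)` up to the required minimum `2`.
  obtain ⟨D, hDe, hD⟩ := exists_subset_card_eq (s := (univ.map e)ᶜ) (n := 2) (by omega)
  obtain ⟨Q, -, hQ⟩ := exists_subset_card_eq (s := (univ : Finset (Fin n))) (n := m + 3) (by
    rw [card_univ, Fintype.card_fin]
    omega)
  have hdisj : ∀ A : Finset (Fin m), Disjoint (A.map e) D := fun A =>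
    disjoint_compl_right.mono (hmap A) hDe
  have hcard : ∀ A : Finset (Fin m), #(A.map e ∪ D) = #A + 2 := fun A => by
    rw [card_union_of_disjoint (hdisj A), card_map, hD]
  have hσ : ∀ B : Finset (Fin m), ∃ σ : Equiv.Perm (Fin n),
      ∀ i ∈ univ.map e ∪ D, σ i ∈ Q ↔ i ∈ B.map e := fun B => by
    have hB := card_finset_fin_le B
    refine exists_perm_forall_mem_iff ?_ (le_trans ?_ (card_le_card subset_union_right))
    · rw [card_map]
      omega
    · rw [card_compl, hcard, card_univ, Fintype.card_fin, Fintype.card_fin]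
      omega
  choose σ hσ using hσ
  refine ⟨Q, fun A => A.map e ∪ D, σ, fun A => ?_, fun A B => ?_⟩
  · rw [isQAP3Param_empty_two_iff, hcard]
    have hA := card_finset_fin_le A
    omega
  · have hDB : ∀ i ∈ D, i ∉ B.map e := fun i hi hiB => disjoint_left.1 (hdisj B) hiB hi
    rw [← card_map e, map_inter,
      filter_congr fun i hi => hσ B i (union_subset_union_left (hmap A) hi)]
    congr 1
    ext i
    rw [mem_filter, mem_union, mem_inter]
    have := hDB i
    tauto

theorem three_pow_le_extensionComplexity_add_one_mul {m : ℕ} (hmn : 2 * m + 7 ≤ n)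
    {R : Set (QAPSpace n)} (hR : IsBoundedQAPRelaxation R)
    (hvalid : ∀ P Q : Finset (Fin n), IsQAP3Param n P ∅ Q 2 →
      ∀ Y ∈ R, -1 ≤ qap3Lhs P ∅ Q 2 Y) :
    3 ^ m ≤ (extensionComplexity R + 1) * 2 ^ m := by
  obtain ⟨Q, P, σ, hparam, hcount⟩ := exists_isQAP3Param_card_eq_card_inter hmn
  have hvertex : ∀ A B, qap3LhsLinear (P A) ∅ Q 2 (qapVertex (σ B)) =
      -1 + ((#(A ∩ B) : ℝ) - 2) * (#(A ∩ B) - 1) / 2 := fun A B => by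
    refine (qap3Lhs_qapVertex (P A) ∅ Q 2 (σ B) rfl).trans ?_
    rw [hcount, filter_empty, card_empty]
    push_cast
    ring
  have hcover : IsUnionOfRectangles {p : Finset (Fin m) × Finset (Fin m) |
      0 < ((#(p.1 ∩ p.2) : ℝ) - 2) * (#(p.1 ∩ p.2) - 1)} (extensionComplexity R + 1) := by
    convert hR.1.isUnionOfRectangles_slack_extensionComplexity
      (f := fun A => -qap3LhsLinear (P A) ∅ Q 2) (c := fun _ => 1) (v := fun B => qapVertex (σ B))
      (fun A Y hY => neg_le.1 (hvalid _ _ (hparam A) Y hY))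
      (fun B => hR.2 (subset_convexHull ℝ _ ⟨σ B, rfl⟩)) using 3 with p
    rw [LinearMap.neg_apply, hvertex]
    constructor <;> intro h <;> linarith
  have hbound := hcover.three_pow_le_mul_two_pow
    (fun A B hAB => by simp [disjoint_iff_inter_eq_empty.1 hAB])
    (fun A B hAB => by simp [hAB])
  rwa [Fintype.card_fin] at hbound

end QAP

theorem two_rpow_add_one_le_three_halves_pow {x : ℝ} {m : ℕ} (hx : 0 ≤ x) (hxm : x + 1 ≤ m / 2) :
    (2 : ℝ) ^ x + 1 ≤ (3 / 2) ^ m := by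
  have hsqrt : (2 : ℝ) ^ (1 / 2 : ℝ) ≤ 3 / 2 := by
    rw [← Real.sqrt_eq_rpow, Real.sqrt_le_left (by norm_num)]
    norm_num
  have hone : (1 : ℝ) ≤ 2 ^ x := Real.one_le_rpow one_le_two hx
  calc (2 : ℝ) ^ x + 1 ≤ 2 ^ x * 2 := by linarith
    _ = 2 ^ (x + 1) := by rw [Real.rpow_add_one two_ne_zero]
    _ ≤ 2 ^ (1 / 2 * (m : ℝ)) :=
        Real.rpow_le_rpow_of_exponent_le one_le_two (by linarith)
    _ = ((2 : ℝ) ^ (1 / 2 : ℝ)) ^ m := by rw [Real.rpow_mul zero_le_two, Real.rpow_natCast]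
    _ ≤ (3 / 2) ^ m := pow_le_pow_left₀ (by positivity) hsqrt m

theorem mainTheorem4_general :
    ∃ c : ℝ, 0 < c ∧ ∃ N : ℕ, ∀ n : ℕ, N ≤ n → ∀ R : Set (QAPSpace n),
      IsBoundedQAPRelaxation R →
      (∀ P Q : Finset (Fin n), IsQAP3Param n P ∅ Q 2 → ∀ Y ∈ R, -1 ≤ qap3Lhs P ∅ Q 2 Y) →
        (2 : ℝ) ^ (c * (n : ℝ)) ≤ (extensionComplexity R : ℝ) := by
  refine ⟨1 / 8, by norm_num, 24, fun n hn R hR hvalid => ?_⟩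
  obtain ⟨m, hmn, hnm⟩ : ∃ m, 2 * m + 7 ≤ n ∧ n ≤ 2 * m + 8 := ⟨(n - 7) / 2, by omega, by omega⟩
  have hrect : (3 : ℝ) ^ m ≤ (extensionComplexity R + 1) * 2 ^ m := by
    exact_mod_cast three_pow_le_extensionComplexity_add_one_mul hmn hR hvalid
  have hxc : (3 / 2 : ℝ) ^ m ≤ extensionComplexity R + 1 := by
    rwa [div_pow, div_le_iff₀ (by positivity)]
  have hexp : 1 / 8 * (n : ℝ) + 1 ≤ m / 2 := by
    have hn : (24 : ℝ) ≤ n := by exact_mod_cast hn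
    have hnm : (n : ℝ) ≤ 2 * m + 8 := by exact_mod_cast hnm
    linarith
  linarith [two_rpow_add_one_le_three_halves_pow (by positivity) hexp]

theorem mainTheorem4 :
    ∃ c : ℝ, 0 < c ∧ ∃ N : ℕ, ∀ n : ℕ, N ≤ n → ∀ R : Set (QAPSpace n),
      IsBoundedQAPRelaxation R → QAP3Valid R →
        (2 : ℝ) ^ (c * (n : ℝ)) ≤ (extensionComplexity R : ℝ) := by
  obtain ⟨c, hc, N, h⟩ := mainTheorem4_general
  exact ⟨c, hc, N, fun n hn R hR hvalid => h n hn R hR fun P Q hPQ Y hY =>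
    (by norm_num : (-1 : ℝ) = _).trans_le (hvalid P ∅ Q 2 hPQ Y hY)⟩
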